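/- **Conventions.** $[\omega]^\omega$ is the set of infinite subsets of $\omega$; a family $\mathcal N\subseteq[\omega]^\omega$ is *dense in* $[\omega]^\omega$ if every infinite $A\subseteq\omega$ contains some $B\in\mathcal N$. A family $\mathcal A\subseteq\mathcal P(\omega)$ is *almost disjoint* if $A\cap B$ is finite for any distinct $A,B\in\mathcal A$. $\mathfrak c$ is the cardinality of the continuum, and $\mathfrak p$ is the least cardinality of a family $\mathcal B\subseteq\mathcal P(\omega)$ such that all finite subfamilies of $\mathcal B$ have infinite intersection but there is no infinite $A\subseteq\omega$ with $A\setminus B$ finite for every $B\in\mathcal B$. For a Boolean algebra $\mathfrak B$, $M(\mathfrak B)$ is the space of all finitely additive functions $\mu:\mathfrak B\to\mathbb R$ of finite variation, with the topology of pointwise convergence on $\mathfrak B$, and with the norm $\|\mu\|=\sup_{B\in\mathfrak B}\left(|\mu(B)|+|\mu(1\setminus B)|\right)$. It is identified with the space $M(\mathrm{ult}(\mathfrak B))=C(\mathrm{ult}(\mathfrak B))^*$ of signed Radon measures on the Stone space $\mathrm{ult}(\mathfrak B)$ of ultrafilters on $\mathfrak B$, via $\mu(B)=\mu(\{x:B\in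 x\})$. $M^{\ell_1}(\mathcal P(\omega))$ is the subspace of $M(\mathcal P(\omega))$ of those $\mu$ for which there is $x\in\ell_1$ with $\mu(B)=\sum_{n\in B}x(n)$ for all $B\subseteq\omega$. Given a compact Hausdorff space $K$ and $c,\varepsilon>0$, three measures $d\,\delta_{x_i}+\nu_i\in M(K)$, $i=0,1,2$ (with a common $d\in\mathbb R$), form a *$(c,\varepsilon)$-fork* if $|d|\ge c$, the points $x_0,x_1,x_2\in K$ are distinct, and $\|\nu_i-\nu_j\|\le\varepsilon$ for $i,j=0,1,2$. A subset of $M(\mathfrak B)$ contains a $(c,\varepsilon)$-fork if the corresponding set of measures on $\mathrm{ult}(\mathfrak B)$ contains three measures that form one. **Theorem 3.4.** Assume $\mathfrak p=\mathfrak c$, and let $\{\mathcal N_\alpha:\alpha<\mathfrak c\}$ be a list of families that are dense in $[\omega]^\omega$. Then there is an almost disjoint family $\mathcal A\subseteq\mathcal P(\omega)$ such that the algebra $\mathfrak B\subseteq\mathcal P(\omega)$ generated by $\mathcal A$ and the finite sets has the following property. For every $0<c<1$, every sequence $(\mu_n)_{n\in\omega}$ in the unit ball of $M^{\ell_1}(\mathcal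 P(\omega))$ satisfying $|\mu_n(\{n\})|\ge c$ for all $n\in\omega$, and every $\alpha<\mathfrak c$, there are $N\in\mathcal N_\alpha$ and $I\subseteq N$ such that the closure of $\{\mu_k|_{\mathfrak B}:k\in I\}$ in $M(\mathfrak B)$ contains a $(c,c/2)$-fork. -/

import Mathlib

/-! ### Infinite sets of natural numbers -/

/-- The strong finite intersection property: finite intersections are infinite. -/
def HasSFIP (𝓑 : Set (Set ℕ)) : Prop :=
  ∀ F : Finset (Set ℕ), (F : Set (Set ℕ)) ⊆ 𝓑 → (⋂₀ (F : Set (Set ℕ))).Infinite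

/-- `A` is an infinite set almost contained in every member of `𝓑`. -/
def IsPseudoIntersection (A : Set ℕ) (𝓑 : Set (Set ℕ)) : Prop :=
  A.Infinite ∧ ∀ B ∈ 𝓑, (A \ B).Finite

/-- The cardinal `𝔭`: the least size of a family with the strong finite intersection property
which has no infinite pseudo-intersection. -/
noncomputable def pseudointersectionNumber : Cardinal.{0} :=
  sInf {κ | ∃ 𝓑 : Set (Set ℕ), Cardinal.mk 𝓑 = κ ∧ HasSFIP 𝓑 ∧
    ¬ ∃ A, IsPseudoIntersection A 𝓑}

/-- `𝒩` is a family of infinite subsets of `ω` such that every infinite subset of `ω` contains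
a member of `𝒩`. -/
def IsDenseFamily (𝒩 : Set (Set ℕ)) : Prop :=
  (∀ B ∈ 𝒩, B.Infinite) ∧ ∀ A : Set ℕ, A.Infinite → ∃ B ∈ 𝒩, B ⊆ A

def IsAlmostDisjoint (𝒜 : Set (Set ℕ)) : Prop :=
  ∀ A ∈ 𝒜, ∀ B ∈ 𝒜, A ≠ B → (A ∩ B).Finite

/-- The algebra of subsets of `ω` generated by `𝒜` and the finite sets. -/
def generatedAlgebra (𝒜 : Set (Set ℕ)) : BooleanSubalgebra (Set ℕ) :=
  BooleanSubalgebra.closure (𝒜 ∪ {F | F.Finite})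

/-! ### Finitely additive signed measures on a Boolean algebra -/

/-- `M(𝔅)`: finitely additive signed measures (of finite variation) on a Boolean algebra. -/
structure FinAddMeasure (𝔅 : Type*) [BooleanAlgebra 𝔅] where
  toFun : 𝔅 → ℝ
  map_sup' : ∀ a b : 𝔅, Disjoint a b → toFun (a ⊔ b) = toFun a + toFun b
  bounded' : ∃ C : ℝ, ∀ a, |toFun a| ≤ C

namespace FinAddMeasure

variable {𝔅 : Type*} [BooleanAlgebra 𝔅]

instance : CoeFun (FinAddMeasure 𝔅) (fun _ => 𝔅 → ℝ) := ⟨toFun⟩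

/-- The topology of pointwise convergence on the elements of the algebra. -/
instance : TopologicalSpace (FinAddMeasure 𝔅) :=
  TopologicalSpace.induced (fun μ : FinAddMeasure 𝔅 => (μ : 𝔅 → ℝ)) inferInstance

/-- The variation `|μ|(a) = sup {|μ(b)| + |μ(a \ b)| : b ≤ a}`. -/
noncomputable def variation (μ : FinAddMeasure 𝔅) (a : 𝔅) : ℝ :=
  sSup {r | ∃ b ≤ a, r = |μ b| + |μ (a \ b)|}

/-- The norm `‖μ‖ = |μ|(1)`. -/
noncomputable instance : Norm (FinAddMeasure 𝔅) := ⟨fun μ => μ.variation ⊤⟩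

/-- Restriction of a measure to a subalgebra. -/
def restrict (μ : FinAddMeasure 𝔅) (ℭ : BooleanSubalgebra 𝔅) : FinAddMeasure ℭ where
  toFun a := μ (a : 𝔅)
  map_sup' a b h := by
    have h' : Disjoint (a : 𝔅) (b : 𝔅) := by
      rw [disjoint_iff] at h ⊢
      simpa using congrArg (fun z : ℭ => (z : 𝔅)) h
    exact μ.map_sup' _ _ h'
  bounded' := by
    obtain ⟨C, hC⟩ := μ.bounded'
    exact ⟨C, fun a => hC a⟩

/-- The measures on `𝒫(ω)` of the form `μ(B) = ∑_{n ∈ B} x(n)` with `x ∈ ℓ₁`. -/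
def IsEllOne (μ : FinAddMeasure (Set ℕ)) : Prop :=
  ∃ x : lp (fun _ : ℕ => ℝ) 1, ∀ B : Set ℕ, HasSum (fun n : B => x n) (μ B)

end FinAddMeasure

/-! ### The Stone space of a Boolean algebra -/

/-- Ultrafilters on a Boolean algebra. -/
@[ext]
structure Ult (𝔅 : Type*) [BooleanAlgebra 𝔅] where
  carrier : Set 𝔅
  top_mem' : ⊤ ∈ carrier
  inf_mem' : ∀ {a b}, a ∈ carrier → b ∈ carrier → a ⊓ b ∈ carrier
  mem_of_le' : ∀ {a b}, a ∈ carrier → a ≤ b → b ∈ carrier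
  compl_mem_iff' : ∀ a, aᶜ ∈ carrier ↔ a ∉ carrier

namespace Ult

variable {𝔅 : Type*} [BooleanAlgebra 𝔅]

/-- The set of ultrafilters containing `a`. -/
def basic (a : 𝔅) : Set (Ult 𝔅) := {x | a ∈ x.carrier}

/-- The Stone topology, generated by the sets `basic a`. -/
instance : TopologicalSpace (Ult 𝔅) := TopologicalSpace.generateFrom (Set.range basic)

theorem isOpen_basic (a : 𝔅) : IsOpen (basic a) :=
  TopologicalSpace.isOpen_generateFrom_of_mem ⟨a, rfl⟩

theorem basic_compl (a : 𝔅) : basic aᶜ = (basic a)ᶜ := by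
  ext x
  exact x.compl_mem_iff' a

theorem isClopen_basic (a : 𝔅) : IsClopen (basic a) := by
  refine ⟨⟨?_⟩, isOpen_basic a⟩
  rw [← basic_compl]
  exact isOpen_basic _

instance : CompactSpace (Ult 𝔅) := by
  refine ⟨isCompact_iff_ultrafilter_le_nhds.2 fun F _ => ?_⟩
  refine ⟨⟨{a | basic a ∈ F}, ?_, ?_, ?_, ?_⟩, Set.mem_univ _, ?_⟩
  · exact Filter.mem_of_superset Filter.univ_mem fun x _ => x.top_mem'
  · intro a b ha hb
    exact Filter.mem_of_superset (Filter.inter_mem ha hb) fun x hx => x.inf_mem' hx.1 hx.2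
  · intro a b ha hab
    exact Filter.mem_of_superset ha fun x hx => x.mem_of_le' hx hab
  · intro a
    change basic aᶜ ∈ F ↔ basic a ∉ F
    rw [basic_compl]
    exact Ultrafilter.compl_mem_iff_notMem
  · rw [TopologicalSpace.nhds_generateFrom]
    refine le_iInf₂ ?_
    rintro _ ⟨hx, a, rfl⟩
    exact Filter.le_principal_iff.2 hx

instance : T2Space (Ult 𝔅) := by
  have key : ∀ x y : Ult 𝔅, ∀ a, a ∈ x.carrier → a ∉ y.carrier →
      ∃ u v : Set (Ult 𝔅), IsOpen u ∧ IsOpen v ∧ x ∈ u ∧ y ∈ v ∧ Disjoint u v := by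
    intro x y a hx hy
    exact ⟨basic a, (basic a)ᶜ, isOpen_basic a, (isClopen_basic a).compl.isOpen, hx, hy,
      disjoint_compl_right⟩
  refine ⟨fun x y hxy => ?_⟩
  by_contra hne
  apply hxy
  ext a
  constructor
  · intro hx
    by_contra hy
    exact hne (key x y a hx hy)
  · intro hy
    by_contra hx
    obtain ⟨u, v, hu, hv, h1, h2, h3⟩ := key y x a hy hx
    exact hne ⟨v, u, hv, hu, h2, h1, h3.symm⟩

/-- The characteristic function of the clopen set `basic a`, as an element of `C(ult(𝔅))`. -/
noncomputable def indicatorCM (a : 𝔅) : C(Ult 𝔅, ℝ) where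
  toFun := (basic a).indicator 1
  continuous_toFun := continuous_one.indicator (by simp [(isClopen_basic a).frontier_eq])

end Ult

/-! ### Measures on compact spaces, and forks -/

/-- `M(K) = C(K)*`: signed Radon measures on `K`, identified with continuous linear functionals
on `C(K)`, with the dual norm. -/
abbrev RadonMeasures (K : Type*) [TopologicalSpace K] [CompactSpace K] : Type _ :=
  StrongDual ℝ C(K, ℝ)

/-- The point mass `δ_x`. -/
noncomputable def pointMass {K : Type*} [TopologicalSpace K] [CompactSpace K] (x : K) :
    RadonMeasures K :=
  ContinuousMap.evalCLM ℝ x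

/-- Three measures `m i = d • δ_{x i} + ν i` form a `(c, ε)`-fork. -/
def IsFork {K : Type*} [TopologicalSpace K] [CompactSpace K] [T2Space K] (c ε : ℝ)
    (m : Fin 3 → RadonMeasures K) : Prop :=
  ∃ (d : ℝ) (x : Fin 3 → K) (ν : Fin 3 → RadonMeasures K),
    (∀ i, m i = d • pointMass (x i) + ν i) ∧ c ≤ |d| ∧ Function.Injective x ∧
      ∀ i j, ‖ν i - ν j‖ ≤ ε

/-- The Radon measure `m` on `ult(𝔅)` corresponds to the finitely additive measure `μ` on `𝔅`:
`m` gives the clopen set of ultrafilters containing `a` the mass `μ a`. -/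
def Corresponds {𝔅 : Type*} [BooleanAlgebra 𝔅] (m : RadonMeasures (Ult 𝔅))
    (μ : FinAddMeasure 𝔅) : Prop :=
  ∀ a : 𝔅, m (Ult.indicatorCM a) = μ a

/-- A subset of `M(𝔅)` contains a fork if the corresponding set of measures on `ult(𝔅)` does. -/
def ContainsFork {𝔅 : Type*} [BooleanAlgebra 𝔅] (c ε : ℝ) (S : Set (FinAddMeasure 𝔅)) : Prop :=
  ∃ m : Fin 3 → RadonMeasures (Ult 𝔅), IsFork c ε m ∧ ∀ i, ∃ μ ∈ S, Corresponds (m i) μ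

/-!
The almost disjoint family is built by transfinite recursion of length `𝔠`, one step for each
sequence `μ` in the unit ball of `ℓ₁`, each `c` and each dense family `𝒩`. A step adds three sets
`A₀, A₁, A₂` contained in some `N ∈ 𝒩`, and fixes ultrafilters `Uᵢ ∋ Aᵢ`; the fork consists of the
limits of `μ k` along `U₀, U₁, U₂`. Along `Uᵢ` the point masses `δ_k` converge to the point of the
Stone space determined by `Uᵢ`, and these points are distinct because the `Aᵢ` are disjoint. So
it suffices that the numbers `μ k {k}` have the same limit `d` along the three ultrafilters, and
that the limits of `μ k - μ k {k} • δ_k` are close in norm on the final algebra.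

For this, each step passes to smaller and smaller infinite sets.
* Since fewer than `𝔭` sets precede the step, there is an infinite set almost disjoint from all of
  them (`exists_infinite_almostDisjoint`), and it can be thinned out so that the new measures
  converge on all earlier sets, on singletons and on `ω` (`exists_infinite_subset_forall_tendsto`).
* For each earlier step the differences of the limits along its three ultrafilters are bounded
  finitely additive functions on `𝒫(ω)` that vanish on finite sets. Such a function is null on all
  but countably many members of an almost disjoint family of size `𝔠`, so the new sets can be taken
  null for all earlier differences at once (`exists_infinite_subset_forall_null`). Thus later sets
  do not disturb earlier forks.
* Inside `N`, Rosenthal's lemma (`exists_infinite_subset_ellMass_diff_singleton_le`) gives an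
  infinite `M` such that `|μ k|(M \ {k}) ≤ c / 4` for `k ∈ M`. After one more thinning, `μ k M`
  converges along the set from which the `Aᵢ` are taken.

Modulo finite sets, an element of the generated algebra is a finite union of members of the family
or the complement of one. Hence the limits along the three ultrafilters agree on `B \ M` for all
`B` in the algebra (`LimitsAgree.sdiff_of_mem_generatedAlgebra`), so the parts of the limit
measures off `M` coincide, while the parts on `M`, without the point masses, have norm at most
`c / 4`. The members of the fork therefore differ by at most `c / 2` (`exists_isFork`).
-/

open Filter Topology Cardinal

/-! ### Consequences of `𝔭 = 𝔠` -/

/-- Under `𝔭 = 𝔠`, fewer than `𝔠` sets in a proper filter of infinite sets have an infinite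
pseudo-intersection. -/
theorem exists_pseudoIntersection_of_mem_filter
    (hpc : pseudointersectionNumber = Cardinal.continuum.{0}) {κ : Type} (hκ : #κ < 𝔠)
    (f : Filter ℕ) [f.NeBot] (hf : f ≤ cofinite) (B : κ → Set ℕ) (hB : ∀ i, B i ∈ f) :
    ∃ A : Set ℕ, A.Infinite ∧ ∀ i, (A \ B i).Finite := by
  have hlt : #(Set.range B) < pseudointersectionNumber := by
    rw [hpc]; exact Cardinal.mk_range_le.trans_lt hκ
  have := notMem_of_lt_csInf' hlt
  by_contra hcon
  refine this ⟨Set.range B, rfl, ?_, ?_⟩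
  · intro F hF
    have hmem : ⋂₀ (F : Set (Set ℕ)) ∈ f := by
      rw [sInter_mem F.finite_toSet]
      intro s hs
      obtain ⟨i, rfl⟩ := hF hs
      exact hB i
    intro hfin
    have h1 : (⋂₀ (F : Set (Set ℕ)))ᶜ ∈ f := hf hfin.compl_mem_cofinite
    have h2 := inter_mem hmem h1
    rw [Set.inter_compl_self] at h2
    exact NeBot.ne inferInstance (empty_mem_iff_bot.1 h2)
  · rintro ⟨A, hA, hAB⟩
    exact hcon ⟨A, hA, fun i => hAB _ ⟨i, rfl⟩⟩

theorem neBot_cofinite_inf_principal {P : Set ℕ} (hP : P.Infinite) :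
    (cofinite ⊓ 𝓟 P).NeBot := by
  rwa [cofinite_inf_principal_neBot_iff]

/-- Fewer than `𝔠` sets, each almost disjoint from all the pieces `C n` of a partition into
infinite sets, do not form a maximal family: some infinite `P` is almost disjoint from all of
them, and from the pieces. -/
theorem exists_infinite_almostDisjoint
    (hpc : pseudointersectionNumber = Cardinal.continuum.{0}) {κ : Type} (hκ : #κ < 𝔠)
    (C : ℕ → Set ℕ) (hC : ∀ n, (C n).Infinite) (hd : Pairwise (Function.onFun Disjoint C))
    (M : κ → Set ℕ) (hM : ∀ i n, (M i ∩ C n).Finite) :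
    ∃ P : Set ℕ, P.Infinite ∧ (∀ i, (P ∩ M i).Finite) ∧ ∀ n, (P ∩ C n).Finite := by
  -- the sets containing almost all of `C n` for almost all `n`
  let f : Filter ℕ := (atTop : Filter ℕ).bind fun n => cofinite ⊓ 𝓟 (C n)
  have hmem : ∀ S : Set ℕ, S ∈ f ↔ ∀ᶠ n in atTop, S ∈ cofinite ⊓ 𝓟 (C n) := fun S => by
    simp only [f, mem_bind']; rfl
  have hne : f.NeBot := by
    refine ⟨fun h => ?_⟩
    have h1 : (∅ : Set ℕ) ∈ f := by rw [h]; exact mem_bot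
    obtain ⟨n, hn⟩ := ((hmem _).1 h1).exists
    have := neBot_cofinite_inf_principal (hC n)
    exact NeBot.ne inferInstance (empty_mem_iff_bot.1 hn)
  have hle : f ≤ cofinite := fun S hS =>
    (hmem S).2 (Eventually.of_forall fun n => mem_inf_of_left hS)
  have hκ' : #(κ ⊕ ℕ) < 𝔠 := by
    rw [Cardinal.mk_sum]
    simpa using Cardinal.add_lt_of_lt Cardinal.aleph0_le_continuum hκ
      (by simpa using Cardinal.aleph0_lt_continuum)
  obtain ⟨A, hA, hAB⟩ := exists_pseudoIntersection_of_mem_filter hpc hκ' f hle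
    (Sum.elim (fun i => (M i)ᶜ) fun n => (C n)ᶜ) (by
      rintro (i | n)
      · refine (hmem _).2 (Eventually.of_forall fun n => ?_)
        rw [mem_inf_principal]
        refine mem_of_superset (hM i n).compl_mem_cofinite fun m hm hmC hmM => hm ⟨hmM, hmC⟩
      · refine (hmem _).2 ((eventually_gt_atTop n).mono fun k hk => ?_)
        refine mem_inf_of_right fun m hm => ?_
        exact fun h => Set.disjoint_left.1 (hd hk.ne) h hm)
  refine ⟨A, hA, fun i => ?_, fun n => ?_⟩
  · simpa [Set.sdiff_compl] using hAB (Sum.inl i)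
  · simpa [Set.sdiff_compl] using hAB (Sum.inr n)

theorem exists_tendsto_ultrafilter_of_abs_le {f : ℕ → ℝ} {C : ℝ} (hf : ∀ k, |f k| ≤ C)
    (U : Ultrafilter ℕ) : ∃ l, |l| ≤ C ∧ Tendsto f U (𝓝 l) := by
  obtain ⟨l, hl, h⟩ := (isCompact_Icc (a := -C) (b := C)).ultrafilter_le_nhds (U.map f) (by
    rw [le_principal_iff]
    exact Filter.mem_map.2 (Eventually.of_forall fun k => abs_le.1 (hf k)))
  exact ⟨l, abs_le.2 hl, h⟩

/-- Fewer than `𝔠` bounded real sequences converge along a common infinite subset of a given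
infinite set. -/
theorem exists_infinite_subset_forall_tendsto
    (hpc : pseudointersectionNumber = Cardinal.continuum.{0}) {κ : Type} (hκ : #κ < 𝔠)
    {P : Set ℕ} (hP : P.Infinite) (f : κ → ℕ → ℝ) (hf : ∀ i, ∃ C, ∀ k, |f i k| ≤ C) :
    ∃ Q ⊆ P, Q.Infinite ∧ ∀ i, ∃ l, Tendsto (f i) (cofinite ⊓ 𝓟 Q) (𝓝 l) := by
  have := neBot_cofinite_inf_principal hP
  let U : Ultrafilter ℕ := Ultrafilter.of (cofinite ⊓ 𝓟 P)
  have hU : (U : Filter ℕ) ≤ cofinite ⊓ 𝓟 P := Ultrafilter.of_le _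
  have hlim : ∀ i, ∃ l, Tendsto (f i) U (𝓝 l) := fun i => by
    obtain ⟨C, hC⟩ := hf i
    obtain ⟨l, -, hl⟩ := exists_tendsto_ultrafilter_of_abs_le hC U
    exact ⟨l, hl⟩
  choose l hl using hlim
  have hκ' : #(Option (κ × ℕ)) < 𝔠 := by
    rw [Cardinal.mk_option, Cardinal.mk_prod]
    refine Cardinal.add_lt_of_lt Cardinal.aleph0_le_continuum ?_
      (Cardinal.one_lt_aleph0.trans Cardinal.aleph0_lt_continuum)
    simpa using Cardinal.mul_lt_of_lt Cardinal.aleph0_le_continuum hκ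
      (by simpa using Cardinal.aleph0_lt_continuum)
  obtain ⟨A, hA, hAB⟩ := exists_pseudoIntersection_of_mem_filter hpc hκ' (U : Filter ℕ)
    (hU.trans inf_le_left)
    (fun o => o.elim P fun p => {k | |f p.1 k - l p.1| < 1 / ((p.2 : ℝ) + 1)}) (by
      rintro (_ | ⟨i, n⟩)
      · exact hU (mem_inf_of_right (mem_principal_self _))
      · have := Metric.tendsto_nhds.1 (hl i) (1 / ((n : ℝ) + 1)) Nat.one_div_pos_of_nat
        exact this)
  refine ⟨A ∩ P, Set.inter_subset_right, ?_, fun i => ⟨l i, ?_⟩⟩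
  · have h0 : (A \ P).Finite := hAB none
    have h1 := hA.sdiff h0
    refine h1.mono fun k hk => ⟨hk.1, ?_⟩
    by_contra h
    exact hk.2 ⟨hk.1, h⟩
  · rw [Metric.tendsto_nhds]
    intro ε hε
    obtain ⟨n, hn⟩ := exists_nat_one_div_lt hε
    have h0 : (A \ {k | |f i k - l i| < 1 / ((n : ℝ) + 1)}).Finite := hAB (some (i, n))
    rw [eventually_inf_principal]
    filter_upwards [h0.compl_mem_cofinite] with k hk hkA
    rw [Real.dist_eq]
    by_contra hcon
    exact hk ⟨hkA.1, fun h => hcon (lt_trans h hn)⟩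

/-! ### Almost disjoint families and null sets of finitely additive measures -/

/-- Every infinite set carries an almost disjoint family of `𝔠` infinite subsets. -/
theorem exists_continuum_almostDisjoint {P : Set ℕ} (hP : P.Infinite) :
    ∃ D : (ℕ → Bool) → Set ℕ, (∀ b, D b ⊆ P ∧ (D b).Infinite) ∧
      ∀ b b', b ≠ b' → (D b ∩ D b').Finite := by
  -- the branches of the binary tree, coded by elements of `P`
  let e : List Bool → ℕ := fun s => (hP.natEmbedding P (Encodable.encode s) : P)
  have he : Function.Injective e := fun s s' h =>
    Encodable.encode_injective ((hP.natEmbedding P).injective (Subtype.ext h))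
  let br : (ℕ → Bool) → ℕ → List Bool := fun b n => List.ofFn fun i : Fin n => b i
  have hlen : ∀ b n, (br b n).length = n := fun b n => List.length_ofFn
  refine ⟨fun b => Set.range fun n => e (br b n), fun b => ⟨?_, ?_⟩, fun b b' hb => ?_⟩
  · rintro _ ⟨n, rfl⟩
    exact Subtype.property _
  · refine Set.infinite_range_of_injective fun n n' h => ?_
    rw [← hlen b n, he h, hlen]
  · obtain ⟨m, hm⟩ := Function.ne_iff.1 hb
    refine ((Set.finite_Iic m).image fun n => e (br b n)).subset ?_
    rintro _ ⟨⟨n, rfl⟩, n', h⟩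
    have h' := he h
    have hn : n' = n := by rw [← hlen b' n', h', hlen]
    subst hn
    refine ⟨n', ?_, rfl⟩
    by_contra hlt
    have hmn : m < n' := not_le.1 hlt
    have := congrFun (List.ofFn_injective h') ⟨m, hmn⟩
    exact hm this.symm

/-- A bounded finitely additive function on `𝒫(ω)` vanishing on finite sets has, in an almost
disjoint family, only countably many members with a non-null subset. -/
theorem countable_setOf_not_null {ι : Type*} (D : ι → Set ℕ)
    (hD : ∀ b b', b ≠ b' → (D b ∩ D b').Finite) (σ : FinAddMeasure (Set ℕ))
    (hσ : ∀ F : Set ℕ, F.Finite → σ F = 0) :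
    {b | ∃ B ⊆ D b, σ B ≠ 0}.Countable := by
  classical
  obtain ⟨C, hC⟩ := σ.bounded'
  have hdiff : ∀ A B : Set ℕ, (A ∩ B).Finite → σ (A ∪ B) = σ A + σ B := fun A B hAB => by
    have h1 : σ A = σ (A \ B) := by
      have := σ.map_sup' (A \ B) (A ∩ B) Set.disjoint_sdiff_inter
      rw [hσ _ hAB, add_zero] at this
      rw [← this]
      congr 1
      exact (Set.sdiff_union_inter A B).symm
    have h2 := σ.map_sup' (A \ B) B Set.disjoint_sdiff_left
    rw [h1, ← h2]
    congr 1
    exact Set.sdiff_union_self.symm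
  have hsum : ∀ (B : ι → Set ℕ), (∀ b, B b ⊆ D b) → ∀ s : Finset ι,
      σ (⋃ b ∈ s, B b) = ∑ b ∈ s, σ (B b) := by
    intro B hB s
    induction s using Finset.induction_on with
    | empty => simpa using hσ ∅ Set.finite_empty
    | insert a s ha ih =>
      rw [Finset.set_biUnion_insert, Finset.sum_insert ha, ← ih]
      refine hdiff _ _ ?_
      rw [Set.inter_iUnion₂]
      refine s.finite_toSet.biUnion' fun b hb => ?_
      refine (hD a b ?_).subset (Set.inter_subset_inter (hB a) (hB b))
      rintro rfl
      exact ha hb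
  -- for a fixed sign and a fixed lower bound there are only finitely many members
  have hfin : ∀ (sg : ℝ), |sg| = 1 → ∀ n : ℕ,
      {b | ∃ B ⊆ D b, 1 / ((n : ℝ) + 1) < sg * σ B}.Finite := by
    intro sg hsg n
    by_contra hinf
    obtain ⟨k, hk⟩ := exists_nat_gt (C * (n + 1))
    obtain ⟨s, hs, hcard⟩ := Set.Infinite.exists_subset_card_eq hinf k
    have hch : ∀ b, ∃ B ⊆ D b, b ∈ s → 1 / ((n : ℝ) + 1) < sg * σ B := fun b => by
      by_cases hb : b ∈ s
      · obtain ⟨B, h1, h2⟩ := hs hb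
        exact ⟨B, h1, fun _ => h2⟩
      · exact ⟨∅, Set.empty_subset _, fun h => absurd h hb⟩
    choose B hB1 hB2 using hch
    have h1 := hsum B hB1 s
    have h2 : (k : ℝ) * (1 / ((n : ℝ) + 1)) ≤ ∑ b ∈ s, sg * σ (B b) := by
      have := Finset.card_nsmul_le_sum s (fun b => sg * σ (B b)) (1 / ((n : ℝ) + 1))
        fun b hb => (hB2 b hb).le
      rwa [hcard, nsmul_eq_mul] at this
    rw [← Finset.mul_sum, ← h1] at h2
    have h3 : sg * σ (⋃ b ∈ s, B b) ≤ C := by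
      refine (le_abs_self _).trans ?_
      rw [abs_mul, hsg, one_mul]
      exact hC _
    have h4 : (k : ℝ) ≤ C * (n + 1) := by
      have := h2.trans h3
      rwa [mul_one_div, div_le_iff₀ (by positivity)] at this
    linarith
  have hcov : {b | ∃ B ⊆ D b, σ B ≠ 0} ⊆
      ⋃ n : ℕ, {b | ∃ B ⊆ D b, 1 / ((n : ℝ) + 1) < 1 * σ B} ∪
        {b | ∃ B ⊆ D b, 1 / ((n : ℝ) + 1) < (-1) * σ B} := by
    rintro b ⟨B, hB, h0⟩
    obtain ⟨n, hn⟩ := exists_nat_one_div_lt (abs_pos.2 h0)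
    refine Set.mem_iUnion.2 ⟨n, ?_⟩
    rcases abs_cases (σ B) with ⟨h, -⟩ | ⟨h, -⟩
    · exact Or.inl ⟨B, hB, by rw [one_mul, ← h]; exact hn⟩
    · exact Or.inr ⟨B, hB, by rw [neg_one_mul, ← h]; exact hn⟩
  refine (Set.countable_iUnion fun n => ?_).mono hcov
  exact ((hfin 1 (by simp) n).union (hfin (-1) (by simp) n)).countable

/-- Fewer than `𝔠` bounded finitely additive functions vanishing on finite sets are all null on
the subsets of some infinite subset of a given infinite set. -/
theorem exists_infinite_subset_forall_null {κ : Type} (hκ : #κ < 𝔠)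
    (σ : κ → FinAddMeasure (Set ℕ)) (hσ : ∀ i, ∀ F : Set ℕ, F.Finite → σ i F = 0)
    {P : Set ℕ} (hP : P.Infinite) :
    ∃ Q ⊆ P, Q.Infinite ∧ ∀ i, ∀ B ⊆ Q, σ i B = 0 := by
  obtain ⟨D, hD, had⟩ := exists_continuum_almostDisjoint hP
  have hbad : #(⋃ i, {b | ∃ B ⊆ D b, σ i B ≠ 0} : Set (ℕ → Bool)) < 𝔠 := by
    refine (Cardinal.mk_iUnion_le _).trans_lt ?_
    refine Cardinal.mul_lt_of_lt Cardinal.aleph0_le_continuum hκ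
      (lt_of_le_of_lt (ciSup_le' fun i => ?_) Cardinal.aleph0_lt_continuum)
    exact Cardinal.le_aleph0_iff_set_countable.2 (countable_setOf_not_null D had _ (hσ i))
  have hne : (⋃ i, {b | ∃ B ⊆ D b, σ i B ≠ 0} : Set (ℕ → Bool)) ≠ Set.univ := by
    intro h
    rw [h, Cardinal.mk_univ] at hbad
    simp at hbad
  obtain ⟨b, hb⟩ := (Set.ne_univ_iff_exists_notMem _).1 hne
  refine ⟨D b, (hD b).1, (hD b).2, fun i B hB => ?_⟩
  by_contra h0
  exact hb (Set.mem_iUnion.2 ⟨i, B, hB, h0⟩)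

/-! ### Summable sequences as measures, and Rosenthal's lemma -/

/-- The mass `∑_{n ∈ B} y(n)` that a summable sequence `y`, seen as a measure on `ω`, gives
to `B`. -/
noncomputable def ellMass (y : ℕ → ℝ) (B : Set ℕ) : ℝ := ∑' n, B.indicator y n

theorem ellMass_union {y : ℕ → ℝ} (hy : Summable y) {A B : Set ℕ} (h : Disjoint A B) :
    ellMass y (A ∪ B) = ellMass y A + ellMass y B := by
  unfold ellMass
  rw [Set.indicator_union_of_disjoint h]
  exact (hy.indicator A).tsum_add (hy.indicator B)

theorem ellMass_mono {y : ℕ → ℝ} (hy : Summable y) (h0 : ∀ n, 0 ≤ y n) {A B : Set ℕ}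
    (h : A ⊆ B) : ellMass y A ≤ ellMass y B :=
  (hy.indicator A).tsum_le_tsum (fun n => Set.indicator_le_indicator_of_subset h h0 n)
    (hy.indicator B)

theorem abs_ellMass_le {y : ℕ → ℝ} (hy : Summable fun n => |y n|) (B : Set ℕ) :
    |ellMass y B| ≤ ∑' n, |y n| := by
  have hle : ∀ n, |B.indicator y n| ≤ |y n| := fun n => by
    by_cases h : n ∈ B <;> simp [h]
  have hy' : Summable fun n => |B.indicator y n| :=
    Summable.of_nonneg_of_le (fun n => abs_nonneg _) hle hy
  have h1 : ‖∑' n, B.indicator y n‖ ≤ ∑' n, ‖B.indicator y n‖ := norm_tsum_le_tsum_norm hy'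
  exact h1.trans (Summable.tsum_le_tsum hle hy' hy)

theorem exists_disjoint_infinite_subsets {N : Set ℕ} (hN : N.Infinite) :
    ∃ C : ℕ → Set ℕ, (∀ n, C n ⊆ N) ∧ (∀ n, (C n).Infinite) ∧
      Pairwise (Function.onFun Disjoint C) := by
  let e : ℕ → ℕ := fun n => (hN.natEmbedding N n : N)
  have he : Function.Injective e := fun n m h =>
    (hN.natEmbedding N).injective (Subtype.ext h)
  refine ⟨fun n => Set.range fun m => e (Nat.pair n m), fun n => ?_, fun n => ?_,
    fun n n' h => ?_⟩
  · rintro _ ⟨m, rfl⟩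
    exact Subtype.property _
  · refine Set.infinite_range_of_injective fun m m' h => ?_
    exact (Nat.pair_eq_pair.1 (he h)).2
  · refine Set.disjoint_left.2 ?_
    rintro _ ⟨m, rfl⟩ ⟨m', h'⟩
    exact h (Nat.pair_eq_pair.1 (he h')).1.symm

/-- **Rosenthal's lemma**: a bounded sequence of nonnegative measures can be thinned out so that
each of them gives little mass to the indices other than its own. -/
theorem exists_infinite_subset_ellMass_diff_singleton_le {y : ℕ → ℕ → ℝ}
    (hs : ∀ k, Summable (y k)) (h0 : ∀ k n, 0 ≤ y k n) (h1 : ∀ k, ∑' n, y k n ≤ 1)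
    {ε : ℝ} (hε : 0 < ε) {N : Set ℕ} (hN : N.Infinite) :
    ∃ M ⊆ N, M.Infinite ∧ ∀ k ∈ M, ellMass (y k) (M \ {k}) ≤ ε := by
  -- each failure to find such a set inside a piece of a partition lowers the available mass by `ε`
  have key : ∀ j : ℕ, ∀ N : Set ℕ, N.Infinite → (∀ k ∈ N, ellMass (y k) N ≤ j * ε) →
      ∃ M ⊆ N, M.Infinite ∧ ∀ k ∈ M, ellMass (y k) (M \ {k}) ≤ ε := by
    intro j
    induction j with
    | zero =>
      intro N hN h
      refine ⟨N, subset_rfl, hN, fun k hk => ?_⟩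
      refine (ellMass_mono (hs k) (h0 k) Set.sdiff_subset).trans ((h k hk).trans ?_)
      simpa using hε.le
    | succ j ih =>
      intro N hN h
      obtain ⟨C, hCN, hC, hd⟩ := exists_disjoint_infinite_subsets hN
      by_cases hp : ∃ p, ∀ k ∈ C p, ellMass (y k) (C p \ {k}) ≤ ε
      · obtain ⟨p, hp⟩ := hp
        exact ⟨C p, hCN p, hC p, hp⟩
      · push Not at hp
        choose k hkC hk using hp
        have hinj : Function.Injective k := fun p q hpq => by
          by_contra hne
          exact Set.disjoint_left.1 (hd hne) (hkC p) (hpq ▸ hkC q)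
        have hsub : Set.range k ⊆ N := by
          rintro _ ⟨p, rfl⟩
          exact hCN p (hkC p)
        obtain ⟨M, hM, hM', hM''⟩ := ih (Set.range k) (Set.infinite_range_of_injective hinj) (by
          rintro _ ⟨p, rfl⟩
          have hdis : Disjoint (Set.range k) (C p \ {k p}) := by
            refine Set.disjoint_left.2 ?_
            rintro _ ⟨q, rfl⟩ ⟨hq, hne⟩
            refine hne ?_
            have hqp : q = p := by
              by_contra hqp
              exact Set.disjoint_left.1 (hd hqp) (hkC q) hq
            rw [hqp]; rfl
          have hle := ellMass_mono (hs (k p)) (h0 (k p))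
            (Set.union_subset hsub (Set.sdiff_subset.trans (hCN p)) :
              Set.range k ∪ (C p \ {k p}) ⊆ N)
          rw [ellMass_union (hs _) hdis] at hle
          have := h (k p) (hCN p (hkC p))
          have := hk p
          push_cast at *
          linarith)
        exact ⟨M, hM.trans hsub, hM', hM''⟩
  obtain ⟨j, hj⟩ := exists_nat_ge (1 / ε)
  refine key j N hN fun k _ => ?_
  have h2 : ellMass (y k) N ≤ 1 := by
    refine le_trans ?_ (h1 k)
    have := ellMass_mono (hs k) (h0 k) (Set.subset_univ N)
    simpa [ellMass] using this
  rw [div_le_iff₀ hε] at hj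
  exact h2.trans hj

/-! ### Limits along three ultrafilters -/

/-- The measures `x k` give to the set `B` masses with the same limit along each of the three
ultrafilters. -/
def LimitsAgree (x : ℕ → ℕ → ℝ) (U : Fin 3 → Ultrafilter ℕ) (B : Set ℕ) : Prop :=
  ∃ l, ∀ i, Tendsto (fun k => ellMass (x k) B) (U i) (𝓝 l)

namespace LimitsAgree

variable {x : ℕ → ℕ → ℝ} {U : Fin 3 → Ultrafilter ℕ} {A B : Set ℕ}

theorem union (hs : ∀ k, Summable (x k)) (hA : LimitsAgree x U A) (hB : LimitsAgree x U B)
    (h : Disjoint A B) : LimitsAgree x U (A ∪ B) := by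
  obtain ⟨a, ha⟩ := hA
  obtain ⟨b, hb⟩ := hB
  refine ⟨a + b, fun i => ?_⟩
  simp_rw [fun k => ellMass_union (hs k) h]
  exact (ha i).add (hb i)

theorem sdiff (hs : ∀ k, Summable (x k)) (hA : LimitsAgree x U A) (hB : LimitsAgree x U B)
    (h : A ⊆ B) : LimitsAgree x U (B \ A) := by
  obtain ⟨a, ha⟩ := hA
  obtain ⟨b, hb⟩ := hB
  refine ⟨b - a, fun i => ?_⟩
  have h' : ∀ k, ellMass (x k) (B \ A) = ellMass (x k) B - ellMass (x k) A := fun k => by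
    rw [eq_sub_iff_add_eq, ← ellMass_union (hs k) Set.disjoint_sdiff_left,
      Set.sdiff_union_of_subset h]
  simp_rw [h']
  exact (hb i).sub (ha i)

theorem empty : LimitsAgree x U ∅ := ⟨0, fun i => by simp [ellMass]⟩

theorem of_finite (hs : ∀ k, Summable (x k)) (h1 : ∀ m, LimitsAgree x U {m})
    (hA : A.Finite) : LimitsAgree x U A := by
  induction A, hA using Set.Finite.induction_on with
  | empty => exact empty
  | @insert a s ha _ ih =>
    rw [Set.insert_eq]
    exact (h1 a).union hs ih (Set.disjoint_singleton_left.2 ha)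

theorem congr (hs : ∀ k, Summable (x k)) (h1 : ∀ m, LimitsAgree x U {m})
    (hA : LimitsAgree x U A) (hAB : (A \ B).Finite) (hBA : (B \ A).Finite) :
    LimitsAgree x U B := by
  have h2 := (hA.union hs (of_finite hs h1 hBA) Set.disjoint_sdiff_right)
  have h3 := (of_finite hs h1 hAB).sdiff hs h2 (Set.sdiff_subset.trans Set.subset_union_left)
  convert h3 using 1
  ext n
  by_cases hn : n ∈ A <;> by_cases hn' : n ∈ B <;> simp [hn, hn']

end LimitsAgree

/-- The limits along the three ultrafilters are finitely additive, so they agree exactly on the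
common zero sets of finitely additive measures, their differences. -/
theorem exists_finAddMeasure_limitsAgree_iff {x : ℕ → ℕ → ℝ} (hs : ∀ k, Summable fun n => |x k n|)
    (h1 : ∀ k, ∑' n, |x k n| ≤ 1) (U : Fin 3 → Ultrafilter ℕ) :
    ∃ σ : Fin 3 → FinAddMeasure (Set ℕ), ∀ B, LimitsAgree x U B ↔ ∀ i, σ i B = 0 := by
  have hlim : ∀ i B, ∃ l, |l| ≤ 1 ∧ Tendsto (fun k => ellMass (x k) B) (U i) (𝓝 l) :=
    fun i B => exists_tendsto_ultrafilter_of_abs_le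
      (fun k => (abs_ellMass_le (hs k) B).trans (h1 k)) (U i)
  choose ρ hρ1 hρ using hlim
  have hadd : ∀ i A B, Disjoint A B → ρ i (A ∪ B) = ρ i A + ρ i B := fun i A B h => by
    refine tendsto_nhds_unique (hρ i (A ∪ B)) ?_
    simp_rw [fun k => ellMass_union (hs k).of_abs h]
    exact (hρ i A).add (hρ i B)
  refine ⟨fun i => ⟨fun B => ρ i B - ρ 0 B, fun A B h => ?_, 1 + 1, fun B => ?_⟩, fun B => ?_⟩
  · change ρ i (A ∪ B) - ρ 0 (A ∪ B) = _
    rw [hadd i A B h, hadd 0 A B h]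
    ring
  · exact (abs_sub _ _).trans (add_le_add (hρ1 i B) (hρ1 0 B))
  · constructor
    · rintro ⟨l, hl⟩ i
      change ρ i B - ρ 0 B = 0
      rw [tendsto_nhds_unique (hρ i B) (hl i), tendsto_nhds_unique (hρ 0 B) (hl 0), sub_self]
    · intro h
      refine ⟨ρ 0 B, fun i => ?_⟩
      rw [← sub_eq_zero.1 (h i)]
      exact hρ i B

/-! ### One step of the construction -/

/-- What one step of the construction produces: three sets `part i`, to be put into the almost
disjoint family, ultrafilters `ultra i` on them along which the limits are taken, and a larger
set `carrier` on which the measures are controlled. -/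
structure ForkSeed where
  /-- The set, containing the three parts, on which the measures nearly are point masses. -/
  carrier : Set ℕ
  /-- The three new members of the almost disjoint family. -/
  part : Fin 3 → Set ℕ
  /-- The ultrafilters along which the measures converge to the members of the fork. -/
  ultra : Fin 3 → Ultrafilter ℕ

/-- The requirements on the seed `d` for the measures `x k`, the bound `ε` and the dense family
`𝒩` that do not involve other seeds. Almost disjointness of the carrier from the sets `C n` of a
fixed infinite partition keeps room for the later seeds. -/
structure ForkSeed.IsGood (C : ℕ → Set ℕ) (x : ℕ → ℕ → ℝ) (ε : ℝ) (𝒩 : Set (Set ℕ))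
    (d : ForkSeed) : Prop where
  part_subset : ∀ i, d.part i ⊆ d.carrier
  part_disjoint : Pairwise (Function.onFun Disjoint d.part)
  part_mem : ∀ i, d.part i ∈ d.ultra i
  carrier_inter : ∀ n, (d.carrier ∩ C n).Finite
  mass_le : ∀ i, ∀ k ∈ d.part i, ellMass (fun n => |x k n|) (d.carrier \ {k}) ≤ ε
  part_subset_dense : ∃ N ∈ 𝒩, ∀ i, d.part i ⊆ N
  agree_singleton : ∀ m, LimitsAgree x d.ultra {m}
  agree_univ : LimitsAgree x d.ultra Set.univ
  agree_carrier : LimitsAgree x d.ultra d.carrier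
  tendsto_diag : ∃ l, ∀ i, Tendsto (fun k => x k k) (d.ultra i) (𝓝 l)

/-- The requirements on a seed `e` for the measures `y k` constructed after the seed `d` for the
measures `x k`. -/
structure ForkSeed.IsCompatible (x : ℕ → ℕ → ℝ) (d : ForkSeed) (y : ℕ → ℕ → ℝ)
    (e : ForkSeed) : Prop where
  inter_finite : (e.carrier ∩ d.carrier).Finite
  agree_subset : ∀ B ⊆ e.carrier, LimitsAgree x d.ultra B
  agree_part : ∀ i, LimitsAgree y e.ultra (d.part i)

/-- One step: fewer than `𝔠` seeds can be extended by a seed for given measures, bound and dense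
family. Every choice is made by passing to an infinite subset, and each requirement, once met,
is inherited by subsets. -/
theorem exists_forkSeed
    (hpc : pseudointersectionNumber = Cardinal.continuum.{0}) {C : ℕ → Set ℕ}
    (hC : ∀ n, (C n).Infinite) (hd : Pairwise (Function.onFun Disjoint C))
    {κ : Type} (hκ : #κ < 𝔠) (x : κ → ℕ → ℕ → ℝ) (hxs : ∀ t k, Summable fun n => |x t k n|)
    (hx1 : ∀ t k, ∑' n, |x t k n| ≤ 1) (d : κ → ForkSeed)
    (hdC : ∀ t n, ((d t).carrier ∩ C n).Finite)
    (hdx : ∀ t m, LimitsAgree (x t) (d t).ultra {m})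
    (y : ℕ → ℕ → ℝ) (hys : ∀ k, Summable fun n => |y k n|) (hy1 : ∀ k, ∑' n, |y k n| ≤ 1)
    {ε : ℝ} (hε : 0 < ε) {𝒩 : Set (Set ℕ)} (h𝒩 : IsDenseFamily 𝒩) :
    ∃ e : ForkSeed, e.IsGood C y ε 𝒩 ∧ ∀ t, (d t).IsCompatible (x t) y e := by
  have hκ3 : #(κ × Fin 3) < 𝔠 := by
    rw [Cardinal.mk_prod]
    simpa using Cardinal.mul_lt_of_lt Cardinal.aleph0_le_continuum hκ
      ((Cardinal.natCast_lt_aleph0 (n := 3)).trans Cardinal.aleph0_lt_continuum)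
  -- an infinite set almost disjoint from the earlier carriers
  obtain ⟨P₁, hP₁, hP₁M, hP₁C⟩ :=
    exists_infinite_almostDisjoint hpc hκ C hC hd (fun t => (d t).carrier) hdC
  -- a subset invisible to the earlier ultrafilters
  choose σ hσ using fun t => exists_finAddMeasure_limitsAgree_iff (hxs t) (hx1 t) (d t).ultra
  obtain ⟨P₂, hP₂, hP₂i, hP₂σ⟩ := exists_infinite_subset_forall_null hκ3 (fun p => σ p.1 p.2)
    (fun p F hF => (hσ p.1 F).1 (LimitsAgree.of_finite (fun k => (hxs _ k).of_abs) (hdx _) hF) _)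
    hP₁
  -- a subset along which the new measures converge on the earlier parts and on singletons
  have hκ' : #((κ × Fin 3) ⊕ Option ℕ) < 𝔠 := by
    rw [Cardinal.mk_sum]
    simpa using Cardinal.add_lt_of_lt Cardinal.aleph0_le_continuum hκ3
      (by simpa using Cardinal.aleph0_lt_continuum)
  obtain ⟨P₃, hP₃, hP₃i, hP₃l⟩ := exists_infinite_subset_forall_tendsto hpc hκ' hP₂i
    (fun a k => ellMass (y k) (Sum.elim (fun p => (d p.1).part p.2)
      (fun o => o.elim Set.univ fun m => {m}) a))
    (fun a => ⟨1, fun k => (abs_ellMass_le (hys k) _).trans (hy1 k)⟩)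
  obtain ⟨P₄, hP₄, hP₄i, hP₄l⟩ := exists_infinite_subset_forall_tendsto hpc (κ := Unit)
    (by simpa using Cardinal.one_lt_aleph0.trans Cardinal.aleph0_lt_continuum) hP₃i
    (fun _ k => y k k) (fun _ => ⟨1, fun k => ((hys k).le_tsum k fun _ _ => abs_nonneg _).trans
      (hy1 k)⟩)
  obtain ⟨N, hN, hNP⟩ := h𝒩.2 P₄ hP₄i
  obtain ⟨M, hMN, hMi, hM⟩ := exists_infinite_subset_ellMass_diff_singleton_le hys
    (fun k n => abs_nonneg _) hy1 hε (h𝒩.1 N hN)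
  -- `M` depends on the choice in `𝒩`, so convergence on `M` needs one more thinning
  obtain ⟨Q, hQM, hQi, hQl⟩ := exists_infinite_subset_forall_tendsto hpc (κ := Unit)
    (by simpa using Cardinal.one_lt_aleph0.trans Cardinal.aleph0_lt_continuum) hMi
    (fun _ k => ellMass (y k) M) (fun _ => ⟨1, fun k => (abs_ellMass_le (hys k) _).trans (hy1 k)⟩)
  obtain ⟨A, hAQ, hAi, hAd⟩ := exists_disjoint_infinite_subsets hQi
  have hne : ∀ i : Fin 3, (cofinite ⊓ 𝓟 (A i)).NeBot := fun i =>
    neBot_cofinite_inf_principal (hAi i)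
  let U : Fin 3 → Ultrafilter ℕ := fun i => Ultrafilter.of (cofinite ⊓ 𝓟 (A i))
  have hU : ∀ i, (U i : Filter ℕ) ≤ cofinite ⊓ 𝓟 (A i) := fun i => Ultrafilter.of_le _
  have hUQ : ∀ S, Q ⊆ S → ∀ i, (U i : Filter ℕ) ≤ cofinite ⊓ 𝓟 S := fun S hS i =>
    (hU i).trans (inf_le_inf_left _ (principal_mono.2 ((hAQ i).trans hS)))
  have hMP₄ : M ⊆ P₄ := hMN.trans hNP
  have hMP₂ : M ⊆ P₂ := hMP₄.trans (hP₄.trans hP₃)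
  refine ⟨⟨M, fun i => A i, U⟩, ?_, fun t => ?_⟩
  · exact
    { part_subset := fun i => (hAQ i).trans hQM
      part_disjoint := fun i j hij => hAd (fun h => hij (Fin.ext h))
      part_mem := fun i => hU i (mem_inf_of_right (mem_principal_self _))
      carrier_inter := fun n =>
        (hP₁C n).subset (Set.inter_subset_inter_left _ (hMP₂.trans hP₂))
      mass_le := fun i k hk => hM k (hQM (hAQ i hk))
      part_subset_dense := ⟨N, hN, fun i => (hAQ i).trans (hQM.trans hMN)⟩
      agree_singleton := fun m => by
        obtain ⟨l, hl⟩ := hP₃l (Sum.inr (some m))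
        exact ⟨l, fun i => hl.mono_left (hUQ P₃ (hQM.trans (hMP₄.trans hP₄)) i)⟩
      agree_univ := by
        obtain ⟨l, hl⟩ := hP₃l (Sum.inr none)
        exact ⟨l, fun i => hl.mono_left (hUQ P₃ (hQM.trans (hMP₄.trans hP₄)) i)⟩
      agree_carrier := by
        obtain ⟨l, hl⟩ := hQl ()
        exact ⟨l, fun i => hl.mono_left (hUQ Q subset_rfl i)⟩
      tendsto_diag := by
        obtain ⟨l, hl⟩ := hP₄l ()
        exact ⟨l, fun i => hl.mono_left (hUQ P₄ (hQM.trans hMP₄) i)⟩ }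
  · exact
    { inter_finite := (hP₁M t).subset (Set.inter_subset_inter_left _ (hMP₂.trans hP₂))
      agree_subset := fun B hB => (hσ t B).2 fun i => hP₂σ (t, i) B (hB.trans hMP₂)
      agree_part := fun i => by
        obtain ⟨l, hl⟩ := hP₃l (Sum.inl (t, i))
        exact ⟨l, fun j => hl.mono_left (hUQ P₃ (hQM.trans (hMP₄.trans hP₄)) j)⟩ }

/-! ### The transfinite construction -/

/-- Recursive choice along a well-founded relation, for requirements on single values and on
pairs of values. -/
theorem WellFounded.exists_forall_and_forall_rel {ι D : Type*} [Nonempty D] {r : ι → ι → Prop}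
    (hr : WellFounded r) (P : ι → D → Prop) (R : ι → D → ι → D → Prop)
    (H : ∀ t (g : ι → D), (∀ s, r s t → P s (g s)) →
      ∃ d, P t d ∧ ∀ s, r s t → R s (g s) t d) :
    ∃ g : ι → D, ∀ t, P t (g t) ∧ ∀ s, r s t → R s (g s) t (g t) := by
  classical
  let d₀ : D := Classical.arbitrary D
  let good : ∀ t, (ι → D) → D → Prop := fun t g d => P t d ∧ ∀ s, r s t → R s (g s) t d
  let ext : ∀ t, (∀ s, r s t → D) → ι → D := fun t g s => if h : r s t then g s h else d₀
  let g : ι → D := hr.fix fun t g => Classical.epsilon (good t (ext t g))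
  have hg : ∀ t, g t = Classical.epsilon (good t (ext t fun s _ => g s)) := fun t => by
    change hr.fix _ t = _
    rw [WellFounded.fix_eq]
  refine ⟨g, fun t => ?_⟩
  induction t using hr.induction with
  | _ t ih =>
    have hext : ∀ s, r s t → ext t (fun s _ => g s) s = g s := fun s hs => by
      simp [ext, hs]
    have hex : ∃ d, good t (ext t fun s _ => g s) d :=
      H t _ fun s hs => by rw [hext s hs]; exact (ih s hs).1
    have := Classical.epsilon_spec hex
    rw [← hg t] at this
    refine ⟨this.1, fun s hs => ?_⟩
    have h2 := this.2 s hs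
    rwa [hext s hs] at h2

/-- For at most `𝔠` sequences of measures there are seeds any two of which are almost disjoint
and such that the limits belonging to one agree on the parts of the other. -/
theorem exists_forkSeeds
    (hpc : pseudointersectionNumber = Cardinal.continuum.{0}) {ι : Type} (hι : #ι ≤ 𝔠)
    (x : ι → ℕ → ℕ → ℝ) (hxs : ∀ t k, Summable fun n => |x t k n|)
    (hx1 : ∀ t k, ∑' n, |x t k n| ≤ 1) (ε : ι → ℝ) (hε : ∀ t, 0 < ε t)
    (𝒩 : ι → Set (Set ℕ)) (h𝒩 : ∀ t, IsDenseFamily (𝒩 t)) :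
    ∃ (C : ℕ → Set ℕ) (d : ι → ForkSeed), (∀ t, (d t).IsGood C (x t) (ε t) (𝒩 t)) ∧
      ∀ s t, s ≠ t → ((d s).carrier ∩ (d t).carrier).Finite ∧
        ∀ i, LimitsAgree (x t) (d t).ultra ((d s).part i) := by
  obtain ⟨C, -, hC, hCd⟩ := exists_disjoint_infinite_subsets Set.infinite_univ
  obtain ⟨r, hr, hord⟩ := Cardinal.exists_ord_eq ι
  have : Nonempty ForkSeed := ⟨⟨∅, fun _ => ∅, fun _ => hyperfilter ℕ⟩⟩
  obtain ⟨d, hd⟩ := WellFounded.exists_forall_and_forall_rel (r := r) hr.toIsWellFounded.wf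
    (fun t (d : ForkSeed) => d.IsGood C (x t) (ε t) (𝒩 t)) (fun s (d : ForkSeed) t e => d.IsCompatible (x s) (x t) e) (by
      intro t g hg
      have hlt : #{s // r s t} < 𝔠 :=
        lt_of_lt_of_le (by simpa using Cardinal.card_typein_lt (r := r) t hord) hι
      obtain ⟨e, he, hge⟩ := exists_forkSeed hpc hC hCd hlt (fun s => x s) (fun s => hxs s)
        (fun s => hx1 s) (fun s => g s) (fun s => (hg s s.2).carrier_inter)
        (fun s => (hg s s.2).agree_singleton) (x t) (hxs t) (hx1 t) (hε t) (h𝒩 t)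
      exact ⟨e, he, fun s hs => hge ⟨s, hs⟩⟩)
  refine ⟨C, d, fun t => (hd t).1, fun s t hst => ?_⟩
  rcases trichotomous_of r s t with h | h | h
  · have := (hd t).2 s h
    exact ⟨by rw [Set.inter_comm]; exact this.inter_finite, this.agree_part⟩
  · exact absurd h hst
  · have := (hd s).2 t h
    exact ⟨this.inter_finite, fun i => this.agree_subset _ ((hd s).1.part_subset i)⟩

/-! ### The algebra generated by an almost disjoint family -/

/-- Modulo finite sets, every element of the algebra generated by an almost disjoint family and
the finite sets is a union of finitely many members of the family, or the complement of such a
union. -/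
theorem exists_finite_sUnion_of_mem_generatedAlgebra {𝒜 : Set (Set ℕ)}
    (h𝒜 : IsAlmostDisjoint 𝒜) {B : Set ℕ} (hB : B ∈ generatedAlgebra 𝒜) :
    ∃ F ⊆ 𝒜, F.Finite ∧ ((∀ᶠ n in cofinite, n ∈ B ↔ n ∈ ⋃₀ F) ∨
      ∀ᶠ n in cofinite, n ∉ B ↔ n ∈ ⋃₀ F) := by
  -- almost disjointness: almost every point lies in at most one of finitely many members
  have had : ∀ F ⊆ 𝒜, F.Finite → ∀ G ⊆ 𝒜, G.Finite → ∀ᶠ n in cofinite,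
      ∀ A ∈ F, ∀ A' ∈ G, n ∈ A → n ∈ A' → A = A' := by
    intro F hF hFf G hG hGf
    rw [eventually_all_finite hFf]
    intro A hA
    rw [eventually_all_finite hGf]
    intro A' hA'
    by_cases h : A = A'
    · exact Eventually.of_forall fun _ _ _ => h
    · filter_upwards [(h𝒜 A (hF hA) A' (hG hA') h).compl_mem_cofinite] with n hn h1 h2
      exact absurd ⟨h1, h2⟩ hn
  induction hB using BooleanSubalgebra.closure_bot_sup_induction with
  | mem B hB =>
    rcases hB with hB | hB
    · exact ⟨{B}, Set.singleton_subset_iff.2 hB, Set.finite_singleton _,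
        Or.inl (Eventually.of_forall fun n => by simp)⟩
    · refine ⟨∅, Set.empty_subset _, Set.finite_empty, Or.inl ?_⟩
      filter_upwards [Set.Finite.compl_mem_cofinite hB] with n hn
      simpa using hn
  | bot => exact ⟨∅, Set.empty_subset _, Set.finite_empty,
      Or.inl (Eventually.of_forall fun n => by simp)⟩
  | sup B _ B' _ h h' =>
    obtain ⟨F, hF, hFf, h⟩ := h
    obtain ⟨G, hG, hGf, h'⟩ := h'
    have hFG := had F hF hFf G hG hGf
    rcases h with h | h <;> rcases h' with h' | h'
    · refine ⟨F ∪ G, Set.union_subset hF hG, hFf.union hGf, Or.inl ?_⟩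
      filter_upwards [h, h'] with n h h'
      rw [Set.sUnion_union, Set.mem_union, ← h, ← h']
      rfl
    · refine ⟨G \ F, Set.sdiff_subset.trans hG, hGf.sdiff, Or.inr ?_⟩
      filter_upwards [h, h', hFG] with n h h' hn
      change ¬ (n ∈ B ∨ n ∈ B') ↔ _
      rw [not_or, h, h']
      constructor
      · rintro ⟨h1, A, hA, hnA⟩
        exact ⟨A, ⟨hA, fun h => h1 ⟨A, h, hnA⟩⟩, hnA⟩
      · rintro ⟨A, hA, hnA⟩
        refine ⟨?_, A, hA.1, hnA⟩
        rintro ⟨A', hA', hnA'⟩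
        exact hA.2 (hn A' hA' A hA.1 hnA' hnA ▸ hA')
    · refine ⟨F \ G, Set.sdiff_subset.trans hF, hFf.sdiff, Or.inr ?_⟩
      filter_upwards [h, h', hFG] with n h h' hn
      change ¬ (n ∈ B ∨ n ∈ B') ↔ _
      rw [not_or, h, h']
      constructor
      · rintro ⟨⟨A, hA, hnA⟩, h1⟩
        exact ⟨A, ⟨hA, fun h => h1 ⟨A, h, hnA⟩⟩, hnA⟩
      · rintro ⟨A, hA, hnA⟩
        refine ⟨⟨A, hA.1, hnA⟩, ?_⟩
        rintro ⟨A', hA', hnA'⟩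
        exact hA.2 (hn A hA.1 A' hA' hnA hnA' ▸ hA')
    · refine ⟨F ∩ G, Set.inter_subset_left.trans hF, hFf.inter_of_left _, Or.inr ?_⟩
      filter_upwards [h, h', hFG] with n h h' hn
      change ¬ (n ∈ B ∨ n ∈ B') ↔ _
      rw [not_or, h, h']
      constructor
      · rintro ⟨⟨A, hA, hnA⟩, A', hA', hnA'⟩
        exact ⟨A, ⟨hA, hn A hA A' hA' hnA hnA' ▸ hA'⟩, hnA⟩
      · rintro ⟨A, hA, hnA⟩
        exact ⟨⟨A, hA.1, hnA⟩, A, hA.2, hnA⟩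
  | compl B _ h =>
    obtain ⟨F, hF, hFf, h⟩ := h
    refine ⟨F, hF, hFf, h.symm.imp (fun h => h) fun h => ?_⟩
    filter_upwards [h] with n h
    simpa using h

/-- If the limits agree on singletons, on `ω`, on `M`, and on `A \ M` for all members `A` of an
almost disjoint family, then they agree on `B \ M` for all `B` in the generated algebra. -/
theorem LimitsAgree.sdiff_of_mem_generatedAlgebra {x : ℕ → ℕ → ℝ} {U : Fin 3 → Ultrafilter ℕ}
    (hs : ∀ k, Summable (x k)) (h1 : ∀ m, LimitsAgree x U {m}) (huniv : LimitsAgree x U Set.univ)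
    {M : Set ℕ} (hM : LimitsAgree x U M) {𝒜 : Set (Set ℕ)} (h𝒜 : IsAlmostDisjoint 𝒜)
    (hA : ∀ A ∈ 𝒜, LimitsAgree x U (A \ M)) {B : Set ℕ} (hB : B ∈ generatedAlgebra 𝒜) :
    LimitsAgree x U (B \ M) := by
  obtain ⟨F, hF, hFf, h⟩ := exists_finite_sUnion_of_mem_generatedAlgebra h𝒜 hB
  have hFM : LimitsAgree x U (⋃₀ F \ M) := by
    clear h
    induction F, hFf using Set.Finite.induction_on with
    | empty => simpa using LimitsAgree.empty
    | @insert A F hAF hFf ih =>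
      have hA𝒜 := hF (Set.mem_insert _ _)
      have hF𝒜 := (Set.subset_insert A F).trans hF
      have hfin : (A ∩ ⋃₀ F).Finite := by
        rw [Set.sUnion_eq_biUnion, Set.inter_iUnion₂]
        refine hFf.biUnion fun A' hA' => h𝒜 A hA𝒜 A' (hF𝒜 hA') ?_
        rintro rfl
        exact hAF hA'
      have h2 : LimitsAgree x U ((A \ M) \ ⋃₀ F) := by
        refine (hA A hA𝒜).congr hs h1 (hfin.subset ?_) ?_
        · rintro n ⟨hnA, hn⟩
          by_contra hcon
          exact hn ⟨hnA, fun h => hcon ⟨hnA.1, h⟩⟩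
        · rw [Set.sdiff_eq_empty.2 Set.sdiff_subset]
          exact Set.finite_empty
      have h3 := h2.union hs (ih hF𝒜) (Set.disjoint_left.2 fun n hn hn' => hn.2 hn'.1)
      convert h3 using 1
      rw [Set.sUnion_insert]
      ext n
      simp only [Set.mem_sdiff, Set.mem_union]
      tauto
  rcases h with h | h
  · refine hFM.congr hs h1 (Set.Finite.subset h fun n hn hnB => ?_)
      (Set.Finite.subset h fun n hn hnB => ?_)
    · exact hn.2 ⟨hnB.2 hn.1.1, hn.1.2⟩
    · exact hn.2 ⟨hnB.1 hn.1.1, hn.1.2⟩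
  · have hc := hFM.sdiff hs (hM.sdiff hs huniv (Set.subset_univ M))
      (Set.sdiff_subset_sdiff_left (Set.subset_univ _))
    refine hc.congr hs h1 (Set.Finite.subset h fun n hn hnB => ?_)
      (Set.Finite.subset h fun n hn hnB => ?_)
    · refine hn.1.2 ⟨hnB.1 fun hB' => hn.2 ⟨hB', hn.1.1.2⟩, hn.1.1.2⟩
    · exact hn.2 ⟨⟨trivial, hn.1.2⟩, fun h' => hnB.2 h'.1 hn.1.1⟩

/-! ### Functionals on the continuous functions on the Stone space -/

/-- The trace of an ultrafilter on `ω` on a subalgebra of `𝒫(ω)`. -/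
def Ult.ofUltrafilter (𝔅 : BooleanSubalgebra (Set ℕ)) (U : Ultrafilter ℕ) : Ult 𝔅 where
  carrier := {a | (a : Set ℕ) ∈ U}
  top_mem' := Filter.univ_mem
  inf_mem' := fun ha hb => Filter.inter_mem ha hb
  mem_of_le' := fun ha hab => Filter.mem_of_superset ha hab
  compl_mem_iff' := fun _ => Ultrafilter.compl_mem_iff_notMem

theorem Ult.tendsto_ofUltrafilter_pure (𝔅 : BooleanSubalgebra (Set ℕ)) (U : Ultrafilter ℕ) :
    Tendsto (fun n => Ult.ofUltrafilter 𝔅 (pure n)) U (𝓝 (Ult.ofUltrafilter 𝔅 U)) := by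
  rw [TopologicalSpace.nhds_generateFrom]
  refine tendsto_iInf.2 fun s => tendsto_iInf.2 ?_
  rintro ⟨ha, a, rfl⟩
  exact tendsto_principal.2 ha

/-- A continuous linear functional on `C(ult(𝔅))` is determined by its values on the
characteristic functions of clopen sets. -/
theorem Ult.strongDual_ext {𝔅 : Type*} [BooleanAlgebra 𝔅] {m m' : RadonMeasures (Ult 𝔅)}
    (h : ∀ a, m (Ult.indicatorCM a) = m' (Ult.indicatorCM a)) : m = m' := by
  -- the characteristic functions are closed under products, so they span a subalgebra
  let S : Submonoid C(Ult 𝔅, ℝ) :=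
    { carrier := Set.range Ult.indicatorCM
      one_mem' := ⟨⊤, by
        ext x
        have hx : x ∈ Ult.basic (⊤ : 𝔅) := x.top_mem'
        simp [Ult.indicatorCM, hx]⟩
      mul_mem' := by
        rintro _ _ ⟨a, rfl⟩ ⟨b, rfl⟩
        refine ⟨a ⊓ b, ?_⟩
        ext x
        have hx : x ∈ Ult.basic (a ⊓ b) ↔ x ∈ Ult.basic a ∧ x ∈ Ult.basic b :=
          ⟨fun h => ⟨x.mem_of_le' h inf_le_left, x.mem_of_le' h inf_le_right⟩,
            fun h => x.inf_mem' h.1 h.2⟩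
        by_cases ha : x ∈ Ult.basic a <;> by_cases hb : x ∈ Ult.basic b <;>
          simp [Ult.indicatorCM, hx, ha, hb] }
  have hsep : (Algebra.adjoin ℝ (S : Set C(Ult 𝔅, ℝ))).SeparatesPoints := by
    intro x y hxy
    have hex : ∃ a, ¬ (a ∈ x.carrier ↔ a ∈ y.carrier) := by
      by_contra hcon
      push Not at hcon
      exact hxy (Ult.ext (Set.ext hcon))
    obtain ⟨a, ha⟩ := hex
    refine ⟨_, ⟨Ult.indicatorCM a, Algebra.subset_adjoin ⟨a, rfl⟩, rfl⟩, fun hE => ha ?_⟩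
    change (Ult.basic a).indicator 1 x = (Ult.basic a).indicator (1 : Ult 𝔅 → ℝ) y at hE
    change x ∈ Ult.basic a ↔ y ∈ Ult.basic a
    by_cases hx : x ∈ Ult.basic a <;> by_cases hy : y ∈ Ult.basic a <;> simp_all
  have hdense := ContinuousMap.subalgebra_topologicalClosure_eq_top_of_separatesPoints _ hsep
  have hle : (Algebra.adjoin ℝ (S : Set C(Ult 𝔅, ℝ)) : Set C(Ult 𝔅, ℝ)) ⊆ {f | m f = m' f} := by
    intro f hf
    have hf' : f ∈ Subalgebra.toSubmodule (Algebra.adjoin ℝ (S : Set C(Ult 𝔅, ℝ))) := hf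
    rw [Algebra.adjoin_eq_span, Submonoid.closure_eq] at hf'
    clear hf
    induction hf' using Submodule.span_induction with
    | mem f hf =>
      obtain ⟨a, rfl⟩ := hf
      exact h a
    | zero => simp
    | add f g _ _ hf hg =>
      change m (f + g) = m' (f + g)
      rw [map_add, map_add, hf, hg]
    | smul r f _ hf =>
      change m (r • f) = m' (r • f)
      rw [map_smul, map_smul, hf]
  ext f
  have hcl : IsClosed {f | m f = m' f} := isClosed_eq m.continuous m'.continuous
  have hfm : f ∈ (Algebra.adjoin ℝ (S : Set C(Ult 𝔅, ℝ))).topologicalClosure := by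
    rw [hdense]; trivial
  exact closure_minimal hle hcl hfm

/-- Banach–Alaoglu, along an ultrafilter. -/
theorem exists_strongDual_tendsto {E : Type*} [NormedAddCommGroup E] [NormedSpace ℝ E]
    {T : ℕ → StrongDual ℝ E} (hT : ∀ k, ‖T k‖ ≤ 1) (U : Ultrafilter ℕ) :
    ∃ m : StrongDual ℝ E, ∀ f, Tendsto (fun k => T k f) U (𝓝 (m f)) := by
  have hc := WeakDual.isCompact_closedBall (𝕜 := ℝ) (0 : StrongDual ℝ E) 1
  obtain ⟨m, -, hm⟩ := hc.ultrafilter_le_nhds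
    (U.map fun k => StrongDual.toWeakDual (T k)) (by
      rw [le_principal_iff]
      refine Filter.mem_map.2 (Eventually.of_forall fun k => ?_)
      simpa using hT k)
  exact ⟨WeakDual.toStrongDual m, fun f => ((WeakDual.eval_continuous f).tendsto m).comp hm⟩

section EllFunctional

variable {K : Type*} [TopologicalSpace K] [CompactSpace K]

/-- The functional `f ↦ ∑ y(n) f(p(n))`, that is, the measure `∑ y(n) δ_{p(n)}`. -/
noncomputable def ellFunctional (p : ℕ → K) (y : ℕ → ℝ) : RadonMeasures K :=
  ∑' n, y n • pointMass (p n)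

theorem norm_smul_pointMass_le (p : K) (r : ℝ) : ‖r • pointMass p‖ ≤ |r| := by
  refine ContinuousLinearMap.opNorm_le_bound _ (abs_nonneg r) fun f => ?_
  change ‖r * f p‖ ≤ _
  rw [norm_mul, Real.norm_eq_abs]
  exact mul_le_mul_of_nonneg_left (f.norm_coe_le_norm p) (abs_nonneg r)

theorem hasSum_ellFunctional (p : ℕ → K) {y : ℕ → ℝ} (hy : Summable fun n => |y n|)
    (f : C(K, ℝ)) : HasSum (fun n => y n * f (p n)) (ellFunctional p y f) := by
  have h : Summable fun n => y n • pointMass (p n) :=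
    Summable.of_norm_bounded (E := RadonMeasures K) hy fun n => norm_smul_pointMass_le (p n) (y n)
  have h2 : HasSum (fun n => y n • pointMass (p n)) (ellFunctional p y) := h.hasSum
  exact h2.mapL (ContinuousLinearMap.apply ℝ ℝ f)

theorem norm_ellFunctional_le (p : ℕ → K) {y : ℕ → ℝ} (hy : Summable fun n => |y n|) :
    ‖ellFunctional p y‖ ≤ ∑' n, |y n| :=
  tsum_of_norm_bounded (E := RadonMeasures K) (f := fun n => y n • pointMass (p n)) hy.hasSum
    fun n => norm_smul_pointMass_le (p n) (y n)

theorem ellFunctional_add (p : ℕ → K) {y z : ℕ → ℝ} (hy : Summable fun n => |y n|)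
    (hz : Summable fun n => |z n|) (f : C(K, ℝ)) :
    ellFunctional p (y + z) f = ellFunctional p y f + ellFunctional p z f := by
  have hyz : Summable fun n => |(y + z) n| :=
    (hy.add hz).of_nonneg_of_le (fun n => abs_nonneg _) fun n => abs_add_le _ _
  refine (hasSum_ellFunctional p hyz f).unique ?_
  convert (hasSum_ellFunctional p hy f).add (hasSum_ellFunctional p hz f) using 2 with n
  exact add_mul _ _ _

end EllFunctional

theorem summable_abs_indicator {y : ℕ → ℝ} (hy : Summable fun n => |y n|) (B : Set ℕ) :
    Summable fun n => |B.indicator y n| := by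
  refine (hy.indicator B).congr fun n => ?_
  by_cases h : n ∈ B <;> simp [h]

theorem tsum_abs_indicator (y : ℕ → ℝ) (B : Set ℕ) :
    ∑' n, |B.indicator y n| = ellMass (fun n => |y n|) B := by
  refine tsum_congr fun n => ?_
  by_cases h : n ∈ B <;> simp [h]

theorem ellFunctional_indicator_indicatorCM {𝔅 : BooleanSubalgebra (Set ℕ)} {y : ℕ → ℝ}
    (hy : Summable fun n => |y n|) (B : Set ℕ) (a : 𝔅) :
    ellFunctional (fun n => Ult.ofUltrafilter 𝔅 (pure n)) (B.indicator y) (Ult.indicatorCM a) =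
      ellMass y (a ∩ B) := by
  refine (hasSum_ellFunctional _ (summable_abs_indicator hy B) _).tsum_eq.symm.trans
    (tsum_congr fun n => ?_)
  have hn : Ult.ofUltrafilter 𝔅 (pure n) ∈ Ult.basic a ↔ n ∈ (a : Set ℕ) := Iff.rfl
  change _ * (Ult.basic a).indicator 1 _ = _
  by_cases h : n ∈ (a : Set ℕ) <;> by_cases h' : n ∈ B <;> simp [hn, h, h']

/-- If limits agree off `M`, the measures `x k` for `k ∈ A i` give mass at most `ε` to `M \ {k}`,
and the sets `A i ⊆ M` are disjoint, then the weak* limits of the measures `x k` along three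
ultrafilters on the sets `A i` form a fork. -/
theorem exists_isFork {𝔅 : BooleanSubalgebra (Set ℕ)} {x : ℕ → ℕ → ℝ}
    (hs : ∀ k, Summable fun n => |x k n|) (h1 : ∀ k, ∑' n, |x k n| ≤ 1) {c ε : ℝ}
    (hc : ∀ k, c ≤ |x k k|) (hε : 0 ≤ ε) {U : Fin 3 → Ultrafilter ℕ} {A : Fin 3 → Set ℕ}
    (hA : ∀ i, A i ∈ 𝔅) (hAd : Pairwise (Function.onFun Disjoint A)) (hAU : ∀ i, A i ∈ U i)
    {M : Set ℕ} (hAM : ∀ i, A i ⊆ M)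
    (hM : ∀ i, ∀ k ∈ A i, ellMass (fun n => |x k n|) (M \ {k}) ≤ ε)
    (hdiag : ∃ l, ∀ i, Tendsto (fun k => x k k) (U i) (𝓝 l))
    (hagree : ∀ B ∈ 𝔅, LimitsAgree x U (B \ M)) :
    ∃ m : Fin 3 → RadonMeasures (Ult 𝔅), IsFork c (ε + ε) m ∧
      ∀ i (a : 𝔅), Tendsto (fun k => ellMass (x k) a) (U i) (𝓝 (m i (Ult.indicatorCM a))) := by
  let p : ℕ → Ult 𝔅 := fun n => Ult.ofUltrafilter 𝔅 (pure n)
  have hle : ∀ k, ∀ B : Set ℕ, ‖ellFunctional p (B.indicator (x k))‖ ≤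
      ellMass (fun n => |x k n|) B := fun k B => by
    rw [← tsum_abs_indicator]
    exact norm_ellFunctional_le p (summable_abs_indicator (hs k) B)
  have hle1 : ∀ k, ∀ B : Set ℕ, ‖ellFunctional p (B.indicator (x k))‖ ≤ 1 := fun k B => by
    refine (hle k B).trans (le_trans ?_ (h1 k))
    have := ellMass_mono (hs k) (fun n => abs_nonneg _) (Set.subset_univ B)
    simpa [ellMass] using this
  -- `m i` is the limit of the whole measures, `s i` that of their restrictions to `ω \ M`
  choose m hm using fun i => exists_strongDual_tendsto (fun k => hle1 k Set.univ) (U i)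
  choose s hs' using fun i => exists_strongDual_tendsto (fun k => hle1 k Mᶜ) (U i)
  obtain ⟨l, hl⟩ := hdiag
  have hsij : ∀ i j, s i = s j := fun i j => by
    refine Ult.strongDual_ext fun a => ?_
    obtain ⟨r, hr⟩ := hagree a a.2
    have hlim : ∀ i, s i (Ult.indicatorCM a) = r := fun i => by
      refine tendsto_nhds_unique (hs' i (Ult.indicatorCM a)) ?_
      simp_rw [p, fun k => ellFunctional_indicator_indicatorCM (hs k) Mᶜ a]
      exact hr i
    rw [hlim i, hlim j]
  let ν : Fin 3 → RadonMeasures (Ult 𝔅) := fun i =>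
    m i - l • pointMass (Ult.ofUltrafilter 𝔅 (U i))
  have hν : ∀ i, ‖ν i - s i‖ ≤ ε := fun i => by
    refine ContinuousLinearMap.opNorm_le_bound _ hε fun f => ?_
    have hlim : Tendsto (fun k => ellFunctional p (Set.univ.indicator (x k)) f - x k k * f (p k) -
        ellFunctional p (Mᶜ.indicator (x k)) f) (U i) (𝓝 ((ν i - s i) f)) :=
      ((hm i f).sub ((hl i).mul ((f.continuous.tendsto _).comp
        (Ult.tendsto_ofUltrafilter_pure 𝔅 (U i))))).sub (hs' i f)
    refine le_of_tendsto hlim.norm ?_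
    filter_upwards [hAU i] with k hk
    have hdec : Set.univ.indicator (x k) =
        ({k} : Set ℕ).indicator (x k) + ((M \ {k}).indicator (x k) + Mᶜ.indicator (x k)) := by
      ext n
      have hkM := hAM i hk
      by_cases hn : n = k
      · subst hn; simp [hkM]
      · by_cases hnM : n ∈ M <;> simp [hn, hnM]
    have hsing : ellFunctional p (({k} : Set ℕ).indicator (x k)) f = x k k * f (p k) := by
      refine (hasSum_ellFunctional p (summable_abs_indicator (hs k) _) f).unique ?_
      have := hasSum_single (f := fun n => ({k} : Set ℕ).indicator (x k) n * f (p n)) k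
        fun n hn => by simp [hn]
      simpa using this
    have hsum : Summable fun n => |((M \ {k}).indicator (x k) + Mᶜ.indicator (x k)) n| :=
      ((summable_abs_indicator (hs k) _).add (summable_abs_indicator (hs k) _)).of_nonneg_of_le
        (fun n => abs_nonneg _) fun n => abs_add_le _ _
    rw [hdec, ellFunctional_add p (summable_abs_indicator (hs k) _) hsum,
      ellFunctional_add p (summable_abs_indicator (hs k) _) (summable_abs_indicator (hs k) _),
      hsing, add_sub_cancel_left, add_sub_cancel_right]
    refine (ContinuousLinearMap.le_opNorm _ f).trans ?_
    exact mul_le_mul_of_nonneg_right ((hle k _).trans (hM i k hk)) (norm_nonneg f)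
  refine ⟨m, ⟨l, fun i => Ult.ofUltrafilter 𝔅 (U i), ν, fun i => (add_sub_cancel _ _).symm,
    ge_of_tendsto' (hl 0).abs hc, fun i j hij => ?_, fun i j => ?_⟩, fun i a => ?_⟩
  · by_contra hne
    have hmem : (⟨A i, hA i⟩ : 𝔅) ∈ (Ult.ofUltrafilter 𝔅 (U i)).carrier := hAU i
    have hij' : Ult.ofUltrafilter 𝔅 (U i) = Ult.ofUltrafilter 𝔅 (U j) := hij
    rw [hij'] at hmem
    have hmem' : A i ∈ U j := hmem
    have := inter_mem hmem' (hAU j)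
    rw [Set.disjoint_iff_inter_eq_empty.1 (hAd hne)] at this
    exact (U j).empty_notMem this
  · have : ν i - ν j = (ν i - s i) - (ν j - s j) := by rw [hsij i j]; abel
    rw [this]
    exact (norm_sub_le (ν i - s i) (ν j - s j)).trans (add_le_add (hν i) (hν j))
  · have := hm i (Ult.indicatorCM a)
    simp_rw [p, fun k => ellFunctional_indicator_indicatorCM (hs k) Set.univ a,
      Set.inter_univ] at this
    exact this

/-! ### The almost disjoint family -/

theorem FinAddMeasure.IsEllOne.exists_ellMass {μ : FinAddMeasure (Set ℕ)} (hμ : μ.IsEllOne)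
    (h1 : ‖μ‖ ≤ 1) : ∃ x : ℕ → ℝ, (Summable fun n => |x n|) ∧ ∑' n, |x n| ≤ 1 ∧
      ∀ B : Set ℕ, μ B = ellMass x B := by
  obtain ⟨x, hx⟩ := hμ
  have hmass : ∀ B : Set ℕ, μ B = ellMass (fun n => x n) B := fun B =>
    (hasSum_subtype_iff_indicator.1 (hx B)).tsum_eq.symm
  have hs : Summable fun n => |x n| := by
    have := (lp.memℓp x).summable (by simp)
    simpa using this
  refine ⟨fun n => x n, hs, ?_, hmass⟩
  -- the variation is attained at the set where `x` is nonnegative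
  let P : Set ℕ := {n | 0 ≤ x n}
  obtain ⟨C, hC⟩ := μ.bounded'
  have hbdd : BddAbove {r | ∃ b ≤ (⊤ : Set ℕ), r = |μ b| + |μ (⊤ \ b)|} := by
    refine ⟨C + C, ?_⟩
    rintro _ ⟨b, -, rfl⟩
    exact add_le_add (hC _) (hC _)
  have hP : |μ P| + |μ (⊤ \ P)| ≤ 1 := (le_csSup hbdd ⟨P, le_top, rfl⟩).trans h1
  have hsum : ∑' n, |x n| = μ P - μ (⊤ \ P) := by
    rw [hmass, hmass, ellMass, ellMass,
      ← (hs.of_abs.indicator P).tsum_sub (hs.of_abs.indicator (⊤ \ P))]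
    refine tsum_congr fun n => ?_
    by_cases hn : 0 ≤ x n
    · have h2 : n ∈ P := hn
      have h3 : n ∉ (⊤ : Set ℕ) \ P := fun h => h.2 h2
      rw [Set.indicator_of_mem h2, Set.indicator_of_notMem h3, abs_of_nonneg hn, sub_zero]
    · have h2 : n ∉ P := hn
      have h3 : n ∈ (⊤ : Set ℕ) \ P := ⟨trivial, h2⟩
      rw [Set.indicator_of_notMem h2, Set.indicator_of_mem h3, abs_of_neg (not_le.1 hn), zero_sub]
  rw [hsum]
  refine le_trans ?_ hP
  rw [sub_eq_add_neg]
  exact add_le_add (le_abs_self _) (neg_le_abs _)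

/-- Measures on the Stone space that are limits of the `μ k` along ultrafilters containing `I`
correspond to points of the closure of `{μ k : k ∈ I}`. -/
theorem containsFork_closure_of_isFork {𝔅 : BooleanSubalgebra (Set ℕ)} {x : ℕ → ℕ → ℝ}
    (hs : ∀ k, Summable fun n => |x k n|) (h1 : ∀ k, ∑' n, |x k n| ≤ 1)
    {μ : ℕ → FinAddMeasure (Set ℕ)} (hμ : ∀ k B, μ k B = ellMass (x k) B)
    {U : Fin 3 → Ultrafilter ℕ} {I : Set ℕ} (hI : ∀ i, I ∈ U i) {c ε : ℝ}
    {m : Fin 3 → RadonMeasures (Ult 𝔅)} (hm : IsFork c ε m)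
    (hlim : ∀ i (a : 𝔅),
      Tendsto (fun k => ellMass (x k) a) (U i) (𝓝 (m i (Ult.indicatorCM a)))) :
    ContainsFork c ε (closure ((fun k => (μ k).restrict 𝔅) '' I)) := by
  refine ⟨m, hm, fun i => ?_⟩
  let ρ : FinAddMeasure 𝔅 :=
    { toFun := fun a => m i (Ult.indicatorCM a)
      map_sup' := fun a b hab => by
        have hab' : Disjoint (a : Set ℕ) (b : Set ℕ) := by
          rw [disjoint_iff] at hab ⊢
          exact congrArg Subtype.val hab
        refine tendsto_nhds_unique (hlim i (a ⊔ b)) (((hlim i a).add (hlim i b)).congr fun k => ?_)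
        exact (ellMass_union (hs k).of_abs hab').symm
      bounded' := ⟨1, fun a => le_of_tendsto (hlim i a).abs
        (Eventually.of_forall fun k => (abs_ellMass_le (hs k) _).trans (h1 k))⟩ }
  refine ⟨ρ, ?_, fun a => rfl⟩
  have ht : Tendsto (fun k => (μ k).restrict 𝔅) (U i) (𝓝 ρ) := by
    rw [nhds_induced, tendsto_comap_iff, tendsto_pi_nhds]
    intro a
    refine (hlim i a).congr fun k => ?_
    exact (hμ k a).symm
  exact mem_closure_of_tendsto ht (mem_of_superset (hI i) fun k hk => ⟨k, hk, rfl⟩)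

theorem theorem3p4
    (hpc : pseudointersectionNumber = Cardinal.continuum.{0})
    (𝒩 : Ordinal.{0} → Set (Set ℕ))
    (h𝒩 : ∀ α < Cardinal.continuum.{0}.ord, IsDenseFamily (𝒩 α)) :
    ∃ 𝒜 : Set (Set ℕ), IsAlmostDisjoint 𝒜 ∧
      ∀ c : ℝ, 0 < c → c < 1 →
      ∀ μ : ℕ → FinAddMeasure (Set ℕ), (∀ n, (μ n).IsEllOne) → (∀ n, ‖μ n‖ ≤ 1) →
      (∀ n, c ≤ |μ n {n}|) →
      ∀ α < Cardinal.continuum.{0}.ord,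
      ∃ N ∈ 𝒩 α, ∃ I : Set ℕ, I ⊆ N ∧
        ContainsFork c (c / 2)
          (closure ((fun k => (μ k).restrict (generatedAlgebra 𝒜)) '' I)) := by
  -- one step for each sequence in `ℓ₁`, each `c` and each dense family
  let e : Set.Iio Cardinal.continuum.{0}.ord ≃o Cardinal.continuum.{0}.ord.ToType :=
    Ordinal.ToType.mk
  let ι : Type := {p : (ℕ → ℕ → ℝ) × ℝ × Cardinal.continuum.{0}.ord.ToType //
    (∀ k, Summable fun n => |p.1 k n|) ∧ (∀ k, ∑' n, |p.1 k n| ≤ 1) ∧ 0 < p.2.1}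
  have hι : #ι ≤ 𝔠 := by
    refine (Cardinal.mk_subtype_le _).trans ?_
    simp [Cardinal.mk_real]
  obtain ⟨C, d, hd, hcomp⟩ := exists_forkSeeds hpc hι (fun t => t.1.1) (fun t => t.2.1)
    (fun t => t.2.2.1) (fun t => t.1.2.1 / 4) (fun t => div_pos t.2.2.2 four_pos)
    (fun t => 𝒩 (e.symm t.1.2.2)) (fun t => h𝒩 _ (e.symm t.1.2.2).2)
  let 𝒜 : Set (Set ℕ) := Set.range fun q : ι × Fin 3 => (d q.1).part q.2
  have h𝒜 : IsAlmostDisjoint 𝒜 := by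
    rintro _ ⟨⟨s, i⟩, rfl⟩ _ ⟨⟨t, j⟩, rfl⟩ hne
    by_cases hst : s = t
    · subst hst
      have hij : i ≠ j := fun h => hne (by rw [h])
      have h0 : (d s).part i ∩ (d s).part j = ∅ :=
        Set.disjoint_iff_inter_eq_empty.1 ((hd s).part_disjoint hij)
      exact h0 ▸ Set.finite_empty
    · exact (hcomp s t hst).1.subset
        (Set.inter_subset_inter ((hd s).part_subset i) ((hd t).part_subset j))
  refine ⟨𝒜, h𝒜, fun c hc _ μ hμ hμ1 hμc α hα => ?_⟩
  choose x hs h1 hx using fun n => (hμ n).exists_ellMass (hμ1 n)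
  let t : ι := ⟨(x, c, e ⟨α, hα⟩), hs, h1, hc⟩
  have hg : (d t).IsGood C x (c / 4) (𝒩 (e.symm (e ⟨α, hα⟩))) := hd t
  rw [OrderIso.symm_apply_apply] at hg
  have hs' : ∀ k, Summable (x k) := fun k => (hs k).of_abs
  have hxc : ∀ k, c ≤ |x k k| := fun k => by
    have h2 : ellMass (x k) {k} = x k k := by
      refine (tsum_eq_single k fun n hn => ?_).trans ?_ <;> simp [*]
    rw [← h2, ← hx]
    exact hμc k
  obtain ⟨N, hN, hAN⟩ := hg.part_subset_dense
  refine ⟨N, hN, ⋃ i, (d t).part i, Set.iUnion_subset hAN, ?_⟩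
  -- the parts of `t` lie in its carrier, all other parts are almost disjoint from it
  have hpart : ∀ A ∈ 𝒜, LimitsAgree x (d t).ultra (A \ (d t).carrier) := by
    rintro _ ⟨⟨s, i⟩, rfl⟩
    by_cases hst : s = t
    · have h0 : (d s).part i \ (d t).carrier = ∅ := by
        rw [hst]; exact Set.sdiff_eq_empty.2 ((hd t).part_subset i)
      change LimitsAgree x (d t).ultra ((d s).part i \ (d t).carrier)
      rw [h0]
      exact LimitsAgree.empty
    · refine ((hcomp s t hst).2 i).congr hs' hg.agree_singleton ((hcomp s t hst).1.subset ?_) ?_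
      · rintro n ⟨hn, hn'⟩
        exact ⟨(hd s).part_subset i hn, by_contra fun h => hn' ⟨hn, h⟩⟩
      · exact Set.sdiff_eq_empty.2 Set.sdiff_subset ▸ Set.finite_empty
  obtain ⟨m, hm, hlim⟩ := exists_isFork (𝔅 := generatedAlgebra 𝒜) hs h1 hxc
    (div_nonneg hc.le (by norm_num)) (A := (d t).part) (M := (d t).carrier)
    (fun i => BooleanSubalgebra.subset_closure (Or.inl ⟨(t, i), rfl⟩)) hg.part_disjoint
    hg.part_mem hg.part_subset hg.mass_le hg.tendsto_diag
    (fun B hB => LimitsAgree.sdiff_of_mem_generatedAlgebra hs' hg.agree_singleton hg.agree_univ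
      hg.agree_carrier h𝒜 hpart hB)
  have hc2 : c / 4 + c / 4 = c / 2 := by ring
  rw [hc2] at hm
  exact containsFork_closure_of_isFork hs h1 hx
    (fun i => mem_of_superset (hg.part_mem i) (Set.subset_iUnion _ i)) hm hlim
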